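/- Let $\mathbb{R}^{n+1}_1$ be $\mathbb{R}^{n+1}$ with $\langle x,y\rangle=-x_0y_0+\sum_{i=1}^n x_iy_i$, let $U\subset\mathbb{R}^s$ be open, $s+k=n+1$, let $X:U\to\mathbb{R}^{n+1}_1$ be a smooth spacelike embedding (all non-zero tangent vectors are spacelike), $M=X(U)$ (identified with $U$), and let $N_p(M)$ be the pseudo-normal space at $p=X(u)$. Let $n^T$ be a smooth future directed unit timelike normal vector field along $M$, i.e. $n^T(u)\in N_{X(u)}(M)$, $\langle n^T,n^T\rangle=-1$, $n^T_0>0$. Put $$N_1(M)[n^T]=\{(p,\xi): p=X(u)\in M,\ \xi\in N_p(M),\ \langle\xi,\xi\rangle=1,\ \langle\xi,n^T(u)\rangle=0\},$$ with fibres $N_1(M)_p[n^T]$, and $\mathbb{S}^{n-1}_+=\{x:\langle x,x\rangle=0,\ x_0=1\}$ with the Riemannian metric induced by $\langle\,,\rangle$. The lightcone Gauss map is $$\widetilde{\mathbb{LG}}(n^T):N_1(M)[n^T]\to\mathbb{S}^{n-1}_+,\qquad (p,\xi)\mapsto \frac{n^T(u)+\xi}{n^T_0(u)+\xi_0}.$$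 Identify $T_{(p,\xi)}N_1(M)[n^T]=T_pM\oplus T_\xi N_1(M)_p[n^T]\subset T_pM\oplus N_p(M)=T_p\mathbb{R}^{n+1}_1$ by means of the normal connection: the velocity of a curve $(p(t),\xi(t))$ corresponds to $p'$ plus the orthogonal projection of $\xi'$ onto $T_\xi N_1(M)_p[n^T]$. Give $N_1(M)[n^T]$ the Riemannian metric induced by $\langle\,,\rangle$ through this identification, let $\Pi^\tau$ be the orthogonal projection of $T_p\mathbb{R}^{n+1}_1$ onto $T_{(p,\xi)}N_1(M)[n^T]$, and let $$\widetilde K_\ell(n^T)(p,\xi)=\det\bigl(-\Pi^\tau\circ d_{(p,\xi)}\widetilde{\mathbb{LG}}(n^T)\bigr).$$ **Theorem 6.1.** At every $(p,\xi)\in N_1(M)[n^T]$ the volume elements $d\mathfrak v$ of the two $(n-1)$-dimensional Riemannian manifolds satisfy $$\bigl(\widetilde{\mathbb{LG}}(n^T)^*d\mathfrak v_{\mathbb{S}^{n-1}_+}\bigr)_{(p,\xi)}=|\widetilde K_\ell(n^T)(p,\xi)|\;d\mathfrak v_{N_1(M)[n^T],(p,\xi)},$$ as an equality of volume densities. Equivalently,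 the volume forms of the tangent spaces at $\widetilde{\mathbb{LG}}(n^T)(p,\xi)$ and at $(p,\xi)$ exist, and for any choice of orientations of these two tangent spaces the equality holds for the volume forms up to a sign $\pm1$. -/

import Mathlib

open scoped ContDiff

noncomputable section

/-! ### Embedded submanifolds of a vector space: tangent spaces, differentials, volume forms -/

section General

variable {E F : Type*} [NormedAddCommGroup E] [NormedSpace ℝ E]
  [NormedAddCommGroup F] [NormedSpace ℝ F]

/-- The tangent space at `x` of a subset `S` of a vector space: the span of the tangent cone.
If `S` is an embedded submanifold, this is its usual tangent space, the space of velocities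
at `x` of curves in `S`. -/
def tanSpace (S : Set E) (x : E) : Submodule ℝ E :=
  Submodule.span ℝ (tangentConeAt ℝ S x)

theorem fderivWithin_mem_tanSpace {f : E → F} {S : Set E} {S' : Set F} (hf : Set.MapsTo f S S')
    (x : E) {v : E} (hv : v ∈ tanSpace S x) :
    fderivWithin ℝ f S x v ∈ tanSpace S' (f x) := by
  by_cases hd : DifferentiableWithinAt ℝ f S x
  · have h1 := hd.hasFDerivWithinAt.mapsTo_tangent_cone
    have h2 : tangentConeAt ℝ (f '' S) (f x) ⊆ tangentConeAt ℝ S' (f x) :=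
      tangentConeAt_mono hf.image_subset
    have h3 : tanSpace S x ≤
        (tanSpace S' (f x)).comap (fderivWithin ℝ f S x : E →ₗ[ℝ] F) := by
      refine Submodule.span_le.2 fun w hw => ?_
      exact Submodule.subset_span (h2 (h1 hw))
    exact h3 hv
  · rw [fderivWithin_zero_of_not_differentiableWithinAt hd]
    exact Submodule.zero_mem _

/-- The differential at `x` of a map `f : S → S'` between submanifolds, as a linear map
`T_x S → T_{f x} S'`. For `f` differentiable along `S`, only the values of `f` on `S` matter. -/
def tanMap (f : E → F) {S : Set E} {S' : Set F} (hf : Set.MapsTo f S S') (x : E) :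
    tanSpace S x →ₗ[ℝ] tanSpace S' (f x) :=
  (((fderivWithin ℝ f S x : E →L[ℝ] F) : E →ₗ[ℝ] F).comp (tanSpace S x).subtype).codRestrict
    (tanSpace S' (f x)) fun v => fderivWithin_mem_tanSpace hf x v.2

/-- `vol` is the canonical volume form of the `m`-dimensional inner product space `(V, g)` for one
of its two orientations: `vol = e¹ ∧ ⋯ ∧ eᵐ` for some `g`-orthonormal basis `e`. The two
volume forms of `(V, g)` differ by the sign. -/
def IsVolumeForm {V : Type*} [AddCommGroup V] [Module ℝ V] (g : LinearMap.BilinForm ℝ V) {m : ℕ}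
    (vol : V [⋀^Fin m]→ₗ[ℝ] ℝ) : Prop :=
  ∃ e : Module.Basis (Fin m) ℝ V,
    (∀ i j, g (e i) (e j) = if i = j then 1 else 0) ∧ vol = e.det

end General

/-! ### Lorentz-Minkowski space -/

/-- The underlying vector space of Lorentz-Minkowski `(n+1)`-space. -/
abbrev Mink (n : ℕ) : Type := Fin (n + 1) → ℝ

/-- The pseudo scalar product `-x₀y₀ + x₁y₁ + ⋯ + xₙyₙ`. -/
def lor (n : ℕ) : LinearMap.BilinForm ℝ (Mink n) :=
  LinearMap.mk₂ ℝ (fun x y => -(x 0 * y 0) + ∑ i : Fin n, x i.succ * y i.succ)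
    (fun x x' y => by simp only [Pi.add_apply, add_mul, Finset.sum_add_distrib]; ring)
    (fun c x y => by simp only [Pi.smul_apply, smul_eq_mul, mul_add, Finset.mul_sum]; ring_nf)
    (fun x y y' => by simp only [Pi.add_apply, mul_add, Finset.sum_add_distrib]; ring)
    (fun c x y => by
      simp only [Pi.smul_apply, smul_eq_mul, mul_add, Finset.mul_sum, mul_left_comm]; ring_nf)

theorem lor_apply {n : ℕ} (x y : Mink n) :
    lor n x y = -(x 0 * y 0) + ∑ i : Fin n, x i.succ * y i.succ := rfl

/-- The open lightcone `LC*`. -/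
def lightcone (n : ℕ) : Set (Mink n) := {x | x 0 ≠ 0 ∧ lor n x x = 0}

/-- The lightcone unit `(n-1)`-sphere. -/
def lightSphere (n : ℕ) : Set (Mink n) := {x | lor n x x = 0 ∧ x 0 = 1}

/-- The normalization `x ↦ (1, x₁/x₀, …, xₙ/x₀)` of a lightlike vector. -/
def lightNormalize {n : ℕ} (x : Mink n) : Mink n := (x 0)⁻¹ • x

theorem lightNormalize_mem {n : ℕ} {x : Mink n} (hx : x ∈ lightcone n) :
    lightNormalize x ∈ lightSphere n := by
  refine ⟨?_, ?_⟩
  · simp [lightNormalize, hx.2]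
  · simp [lightNormalize, hx.1]

/-- The canonical Riemannian metric of the lightcone unit sphere at `v`: the restriction of the
pseudo scalar product. -/
def lightSphereMetric (n : ℕ) (v : Mink n) :
    LinearMap.BilinForm ℝ (tanSpace (lightSphere n) v) :=
  (lor n).restrict (tanSpace (lightSphere n) v)

/-! ### Spacelike submanifolds -/

section Submanifold

variable {s n : ℕ}

/-- `X : U → ℝ₁ⁿ⁺¹` is a (smooth) spacelike embedding of the open set `U ⊆ ℝˢ`: every non-zero
tangent vector is spacelike (so that `X` is in particular an immersion) and `X` is a
homeomorphism onto its image. -/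
structure IsSpacelikeEmbedding (U : Set (Fin s → ℝ)) (X : (Fin s → ℝ) → Mink n) : Prop where
  isOpen : IsOpen U
  contDiffOn : ContDiffOn ℝ ∞ X U
  isEmbedding : Topology.IsEmbedding (U.domRestrict X)
  spacelike : ∀ u ∈ U, ∀ a : Fin s → ℝ, a ≠ 0 → 0 < lor n (fderiv ℝ X u a) (fderiv ℝ X u a)

/-- The pseudo-normal space `N_p(M)` of `M = X(U)` at `p = X(u)`. -/
def normalSpace (X : (Fin s → ℝ) → Mink n) (u : Fin s → ℝ) : Set (Mink n) :=
  {w | ∀ a, lor n w (fderiv ℝ X u a) = 0}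

/-- `nT` is a smooth future directed unit timelike normal vector field along `M = X(U)`. -/
structure IsFutureUnitNormal (U : Set (Fin s → ℝ)) (X nT : (Fin s → ℝ) → Mink n) : Prop where
  contDiffOn : ContDiffOn ℝ ∞ nT U
  normal : ∀ u ∈ U, nT u ∈ normalSpace X u
  unit : ∀ u ∈ U, lor n (nT u) (nT u) = -1
  future : ∀ u ∈ U, 0 < nT u 0

/-- The spacelike unit spherical normal bundle `N₁(M)[nT]`, where `M` and `U` are identified
through `X`: its points are the pairs `(u, ξ)` with `ξ ∈ N_p(M)`, `p = X(u)`, `⟨ξ, ξ⟩ = 1` and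
`⟨ξ, nT(u)⟩ = 0`. -/
def unitBundle (U : Set (Fin s → ℝ)) (X nT : (Fin s → ℝ) → Mink n) :
    Set ((Fin s → ℝ) × Mink n) :=
  {q | q.1 ∈ U ∧ q.2 ∈ normalSpace X q.1 ∧ lor n q.2 q.2 = 1 ∧ lor n q.2 (nT q.1) = 0}

/-- The lightcone Gauss image `(u, ξ) ↦ nT(u) + ξ`. -/
def gaussImage (nT : (Fin s → ℝ) → Mink n) (q : (Fin s → ℝ) × Mink n) : Mink n := nT q.1 + q.2

/-- The lightcone Gauss map: the normalization of the lightcone Gauss image. -/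
def gaussMap (nT : (Fin s → ℝ) → Mink n) (q : (Fin s → ℝ) × Mink n) : Mink n :=
  lightNormalize (gaussImage nT q)

theorem gaussImage_mapsTo {U : Set (Fin s → ℝ)} {X nT : (Fin s → ℝ) → Mink n}
    (hn : IsFutureUnitNormal U X nT) :
    Set.MapsTo (gaussImage nT) (unitBundle U X nT) (lightcone n) := by
  rintro ⟨u, ξ⟩ ⟨hu, -, h1, h0⟩
  simp only at hu h1 h0
  have hnn := hn.unit u hu
  have h0' : lor n (nT u) ξ = 0 := by
    rw [← h0, lor_apply, lor_apply]; simp only [mul_comm]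
  have hz : lor n (nT u + ξ) (nT u + ξ) = 0 := by
    simp only [map_add, LinearMap.add_apply, h1, h0, h0', hnn]; norm_num
  refine ⟨fun h => ?_, hz⟩
  have h' : (nT u + ξ) 0 = 0 := h
  have hsum : ∑ i : Fin n, (nT u + ξ) i.succ * (nT u + ξ) i.succ = 0 := by
    have := hz
    rw [lor_apply, h'] at this
    simpa using this
  have hall : ∀ i : Fin n, (nT u + ξ) i.succ = 0 := fun i =>
    mul_self_eq_zero.1
      ((Finset.sum_eq_zero_iff_of_nonneg fun i _ => mul_self_nonneg _).1 hsum i (Finset.mem_univ i))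
  have hzero : nT u + ξ = 0 := by
    ext i
    exact Fin.cases h' hall i
  have : lor n (nT u + ξ) ξ = 1 := by simp [h0', h1]
  rw [hzero] at this
  simp at this

theorem gaussMap_mapsTo {U : Set (Fin s → ℝ)} {X nT : (Fin s → ℝ) → Mink n}
    (hn : IsFutureUnitNormal U X nT) :
    Set.MapsTo (gaussMap nT) (unitBundle U X nT) (lightSphere n) :=
  fun _ hq => lightNormalize_mem (gaussImage_mapsTo hn hq)

/-- The coordinate vector field `X_{u_i}`. -/
def coordVec (X : (Fin s → ℝ) → Mink n) (u : Fin s → ℝ) (i : Fin s) : Mink n :=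
  fderiv ℝ X u (Pi.single i 1)

/-- The first fundamental form `g_ij = ⟨X_{u_i}, X_{u_j}⟩`. -/
def firstForm (X : (Fin s → ℝ) → Mink n) (u : Fin s → ℝ) : Matrix (Fin s) (Fin s) ℝ :=
  Matrix.of fun i j => lor n (coordVec X u i) (coordVec X u j)

/-- The orthogonal projection `T_p ℝ₁ⁿ⁺¹ = T_p M ⊕ N_p(M) → T_p M`,
`w ↦ ∑ g^{ij} ⟨X_{u_i}, w⟩ X_{u_j}`. -/
def projTan (X : (Fin s → ℝ) → Mink n) (u : Fin s → ℝ) : Mink n →ₗ[ℝ] Mink n :=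
  ∑ i, ∑ j, (firstForm X u)⁻¹ i j • (lor n (coordVec X u i)).smulRight (coordVec X u j)

/-- For `q = (u, ξ)` in `N₁(M)[nT]`, the orthogonal projection of `T_p ℝ₁ⁿ⁺¹` onto the tangent
space at `ξ` of the fibre sphere `N₁(M)_p[nT]`, that is, onto the orthogonal complement of `nT(u)`
and `ξ` in `N_p(M)`. -/
def projVert (X nT : (Fin s → ℝ) → Mink n) (q : (Fin s → ℝ) × Mink n) : Mink n →ₗ[ℝ] Mink n :=
  LinearMap.id - projTan X q.1 + (lor n (nT q.1)).smulRight (nT q.1) - (lor n q.2).smulRight q.2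

/-- The canonical identification
`T_{(p,ξ)} N₁(M)[nT] = T_p M ⊕ T_ξ N₁(M)_p[nT] ⊆ T_p M ⊕ N_p(M) = T_p ℝ₁ⁿ⁺¹`.
A tangent vector `(a, η)` has the horizontal part `dX(a)`, and its vertical part is the component
of `η` tangent to the fibre, i.e. the covariant derivative given by the normal connection. -/
def tanIdent (U : Set (Fin s → ℝ)) (X nT : (Fin s → ℝ) → Mink n) (q : (Fin s → ℝ) × Mink n) :
    tanSpace (unitBundle U X nT) q →ₗ[ℝ] Mink n :=
  (((fderiv ℝ X q.1 : (Fin s → ℝ) →L[ℝ] Mink n) : (Fin s → ℝ) →ₗ[ℝ] Mink n).comp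
      (LinearMap.fst ℝ _ _) + (projVert X nT q).comp (LinearMap.snd ℝ _ _)).comp
    (tanSpace (unitBundle U X nT) q).subtype

/-- The canonical Riemannian metric of `N₁(M)[nT]`: the one that makes the decomposition
`T_p M ⊕ T_ξ N₁(M)_p[nT]` orthogonal, with the pseudo scalar product on both summands. -/
def unitBundleMetric (U : Set (Fin s → ℝ)) (X nT : (Fin s → ℝ) → Mink n)
    (q : (Fin s → ℝ) × Mink n) : LinearMap.BilinForm ℝ (tanSpace (unitBundle U X nT) q) :=
  (lor n).comp (tanIdent U X nT q) (tanIdent U X nT q)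

/-- The canonical projection `Π^τ` of `T ℝ₁ⁿ⁺¹` onto `T_{(p,ξ)} N₁(M)[nT]`: the orthogonal
projection onto `T_p M ⊕ T_ξ N₁(M)_p[nT]`, followed by the inverse of the (injective)
identification `tanIdent`, which has exactly this image. -/
def projBundle (U : Set (Fin s → ℝ)) (X nT : (Fin s → ℝ) → Mink n)
    (q : (Fin s → ℝ) × Mink n) : Mink n →ₗ[ℝ] tanSpace (unitBundle U X nT) q :=
  (tanIdent U X nT q).leftInverse.comp (projTan X q.1 + projVert X nT q)

/-- The normalized lightcone Lipschitz-Killing curvature at `q = (u, ξ)`: the determinant of the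
endomorphism `-Π^τ ∘ d(gaussMap)` of `T_{(p,ξ)} N₁(M)[nT]`. -/
def lipschitzKilling {U : Set (Fin s → ℝ)} {X nT : (Fin s → ℝ) → Mink n}
    (hn : IsFutureUnitNormal U X nT) (q : (Fin s → ℝ) × Mink n) : ℝ :=
  LinearMap.det (-((projBundle U X nT q).comp
    ((tanSpace (lightSphere n) (gaussMap nT q)).subtype.comp
      (tanMap (gaussMap nT) (gaussMap_mapsTo hn) q))))

end Submanifold

end

/-! Write ℓ = `nT`(u) + ξ, a null vector. A tangent vector z of the light sphere at the Gauss image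
is orthogonal to ℓ, so ⟨ξ, z⟩ = -⟨`nT`, z⟩, and orthogonal projection off the plane of `nT` and ξ
sends z to z + ⟨`nT`, z⟩ ℓ. Adding a multiple of a null vector orthogonal to all such z changes no
scalar product, so Π^τ is an isometry A there (`projBundle_isometry`). Both tangent spaces have
dimension n - 1 and positive definite metrics, so A has determinant ±1 in orthonormal bases. The
curvature det(-A ∘ D), with D the differential of the Gauss map, is thus up to sign the determinant
of D, which is the volume factor (`IsVolumeForm.compLinearMap_eq`). The remaining work identifies
the tangent spaces as kernels (`tanSpace_eq_ker`) and the image of `tanIdent` as the orthogonal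
complement of `nT` and ξ (`range_tanIdent`). -/

/-! ### Tangent spaces of regular level sets. -/

section LevelSets

variable {E F : Type*} [NormedAddCommGroup E] [NormedSpace ℝ E] [FiniteDimensional ℝ E]
  [NormedAddCommGroup F] [NormedSpace ℝ F] [FiniteDimensional ℝ F]

open Filter Topology in
/-- The tangent space of a regular level set is the kernel of the derivative. -/
theorem tanSpace_eq_ker {f : E → F} {f' : E →L[ℝ] F} {a : E} {S : Set E}
    (hf : HasStrictFDerivAt f f' a) (hf' : f'.range = ⊤)
    (hS : ∀ᶠ x in 𝓝 a, x ∈ S ↔ f x = f a) : tanSpace S a = f'.ker := by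
  have : CompleteSpace E := FiniteDimensional.complete ℝ E
  have : CompleteSpace F := FiniteDimensional.complete ℝ F
  apply le_antisymm
  · have hcongr : tangentConeAt ℝ S a = tangentConeAt ℝ {x | f x = f a} a := by
      refine tangentConeAt_congr (nhdsWithin_eq_iff_eventuallyEq.2 ?_)
      filter_upwards [hS] with x hx
      exact propext hx
    refine Submodule.span_le.2 fun w hw => ?_
    rw [hcongr] at hw
    have h1 := (hf.hasFDerivAt.hasFDerivWithinAt (s := {x | f x = f a})).mapsTo_tangent_cone hw
    have h2 : f '' {x | f x = f a} ⊆ {f a} := by rintro _ ⟨x, hx, rfl⟩; exact hx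
    -- `f` is constant on its level set, so `f'` maps the tangent cone into that of a point, which
    -- is zero.
    have h3 := tangentConeAt_subset_zero (𝕜 := ℝ) (x := f a) (s := {f a})
      (fun h => by
        obtain ⟨y, hy, hne⟩ := accPt_iff_nhds.1 h Set.univ univ_mem
        exact hne hy.2)
    exact h3 (tangentConeAt_mono h2 h1)
  · intro y hy
    -- The implicit function parametrizes the level set by the kernel, with the inclusion as
    -- derivative at 0; every kernel vector is therefore a velocity.
    set g := hf.implicitFunction f f' hf' (f a) with hg
    have hd : HasStrictFDerivAt g f'.ker.subtypeL 0 := hf.to_implicitFunction hf'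
    have hg0 : g 0 = a := hf.implicitFunction_apply_image hf'
    have hlev : ∀ᶠ y in 𝓝 (0 : f'.ker), f (g y) = f a := by
      have := hf.map_implicitFunction_eq hf'
      have ht : Tendsto (fun y : f'.ker => (f a, y)) (𝓝 0) (𝓝 (f a, (0 : f'.ker))) :=
        (Continuous.prodMk_right _).tendsto _
      exact ht.eventually this
    have hcont : Tendsto g (𝓝 0) (𝓝 a) := by
      simpa [ContinuousAt, hg0] using hd.continuousAt
    have hmem : {y | g y ∈ S} ∈ 𝓝 (0 : f'.ker) := by
      filter_upwards [hlev, hcont.eventually hS] with y h1 h2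
      exact h2.2 h1
    have h1 := (hd.hasFDerivAt.hasFDerivWithinAt (s := {y | g y ∈ S})).mapsTo_tangent_cone
    rw [tangentConeAt_of_mem_nhds hmem, hg0] at h1
    refine Submodule.subset_span (tangentConeAt_mono ?_ (h1 (Set.mem_univ (⟨y, hy⟩ : f'.ker))))
    rintro _ ⟨x, hx, rfl⟩
    exact hx

theorem finrank_tanSpace {f : E → F} {f' : E →L[ℝ] F} {a : E} {S : Set E}
    (hf : HasStrictFDerivAt f f' a) (hf' : f'.range = ⊤)
    (hS : ∀ᶠ x in nhds a, x ∈ S ↔ f x = f a) :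
    Module.finrank ℝ F + Module.finrank ℝ (tanSpace S a) = Module.finrank ℝ E := by
  rw [tanSpace_eq_ker hf hf' hS]
  have := LinearMap.finrank_range_add_finrank_ker (f' : E →ₗ[ℝ] F)
  rwa [show LinearMap.range (f' : E →ₗ[ℝ] F) = ⊤ from hf', finrank_top] at this

end LevelSets

/-! ### Volume forms and determinants. -/

section VolumeForms

variable {V W : Type*} [AddCommGroup V] [Module ℝ V] [AddCommGroup W] [Module ℝ W]

theorem exists_isVolumeForm [FiniteDimensional ℝ V] {g : LinearMap.BilinForm ℝ V}
    (hs : ∀ x y, g x y = g y x) (hp : ∀ x, x ≠ 0 → 0 < g x x) {m : ℕ}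
    (hm : Module.finrank ℝ V = m) : ∃ vol : V [⋀^Fin m]→ₗ[ℝ] ℝ, IsVolumeForm g vol := by
  subst hm
  have hsym : LinearMap.IsSymm g := ⟨fun x y => hs x y⟩
  obtain ⟨v, hv⟩ := LinearMap.BilinForm.exists_orthogonal_basis hsym
  have hpos i : 0 < g (v i) (v i) := hp _ (v.ne_zero i)
  have hu i : IsUnit (√(g (v i) (v i)))⁻¹ := by
    have := Real.sqrt_pos.2 (hpos i)
    exact (inv_ne_zero this.ne').isUnit
  refine ⟨_, v.isUnitSMul hu, fun i j => ?_, rfl⟩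
  simp only [Module.Basis.isUnitSMul_apply, map_smul, LinearMap.smul_apply, smul_eq_mul]
  split_ifs with h
  · subst h
    have := Real.sqrt_pos.2 (hpos i)
    field_simp
    rw [Real.sq_sqrt (hpos i).le]
  · have : g (v i) (v j) = 0 := hv h
    simp [this]

/-- A linear isometry has determinant `±1` with respect to orthonormal bases. -/
theorem det_isometry_eq_one_or_neg_one {gV : LinearMap.BilinForm ℝ V}
    {gW : LinearMap.BilinForm ℝ W} {m : ℕ} {A : V →ₗ[ℝ] W}
    (hA : ∀ x y, gW (A x) (A y) = gV x y) (e : Module.Basis (Fin m) ℝ V)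
    (he : ∀ i j, gV (e i) (e j) = if i = j then 1 else 0) (f : Module.Basis (Fin m) ℝ W)
    (hf : ∀ i j, gW (f i) (f j) = if i = j then 1 else 0) :
    f.det (A ∘ e) = 1 ∨ f.det (A ∘ e) = -1 := by
  -- The coordinate matrix of an isometry in orthonormal bases is orthogonal.
  have hM : (f.toMatrix (A ∘ e)).transpose * f.toMatrix (A ∘ e) = 1 := by
    ext i j
    have h := hA (e i) (e j)
    rw [he, ← f.sum_repr (A (e i)), ← f.sum_repr (A (e j))] at h
    simp only [map_sum, map_smul, LinearMap.sum_apply, LinearMap.smul_apply, hf, smul_eq_mul,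
      mul_ite, mul_one, mul_zero, Finset.sum_ite_eq', Finset.mem_univ,
      if_true] at h
    rw [Matrix.one_apply, ← h, Matrix.mul_apply]
    refine Finset.sum_congr rfl fun k _ => ?_
    simp [Module.Basis.toMatrix_apply, mul_comm]
  have hd := congrArg Matrix.det hM
  rw [Matrix.det_mul, Matrix.det_transpose, Matrix.det_one] at hd
  rw [Module.Basis.det_apply]
  exact mul_self_eq_one_iff.1 hd

/-- Top-degree forms are a line, so pulling back by `D` multiplies by its determinant in the bases
`f`, `e`. Composing with the isometry `A` changes this only by a sign, as does negating the
endomorphism. -/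
theorem IsVolumeForm.compLinearMap_eq {gV : LinearMap.BilinForm ℝ V}
    {gW : LinearMap.BilinForm ℝ W} {m : ℕ} {A : V →ₗ[ℝ] W}
    (hA : ∀ x y, gW (A x) (A y) = gV x y) (D : W →ₗ[ℝ] V)
    {α : V [⋀^Fin m]→ₗ[ℝ] ℝ} {β : W [⋀^Fin m]→ₗ[ℝ] ℝ}
    (hV : IsVolumeForm gV α) (hW : IsVolumeForm gW β) :
    α.compLinearMap D = |LinearMap.det (-(A.comp D))| • β ∨
      α.compLinearMap D = -(|LinearMap.det (-(A.comp D))| • β) := by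
  obtain ⟨e, he, rfl⟩ := hV
  obtain ⟨f, hf, rfl⟩ := hW
  have : FiniteDimensional ℝ W := .of_basis f
  have h1 : f.det.compLinearMap A = f.det (A ∘ e) • e.det :=
    AlternatingMap.eq_smul_basis_det e _
  have h2 : LinearMap.det (A.comp D) = f.det (A ∘ e) * e.det (D ∘ f) := by
    have := congrArg (fun γ => γ (D ∘ f)) h1
    simp only [AlternatingMap.compLinearMap_apply, AlternatingMap.smul_apply, smul_eq_mul] at this
    rw [← this, ← mul_one (LinearMap.det _), ← f.det_self, ← Module.Basis.det_comp]
    rfl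
  have h3 : |LinearMap.det (-(A.comp D))| = |e.det (D ∘ f)| := by
    have : -(A.comp D) = (-1 : ℝ) • A.comp D := by simp
    rw [this, LinearMap.det_smul, abs_mul, abs_pow, abs_neg, abs_one, one_pow, one_mul, h2,
      abs_mul]
    rcases det_isometry_eq_one_or_neg_one hA e he f hf with h | h <;> simp [h]
  have h4 : e.det.compLinearMap D = e.det (D ∘ f) • f.det :=
    AlternatingMap.eq_smul_basis_det f _
  rw [h3, h4]
  rcases abs_choice (e.det (D ∘ f)) with h | h <;> rw [h]
  · exact Or.inl rfl
  · right
    ext w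
    simp only [AlternatingMap.neg_apply, AlternatingMap.smul_apply, smul_eq_mul]
    ring

end VolumeForms

/-! ### Lorentzian geometry and the light sphere. -/

section Lorentz

variable {n : ℕ}

theorem lor_comm (x y : Mink n) : lor n x y = lor n y x := by
  simp only [lor_apply, mul_comm]

/-- A vector orthogonal to a unit timelike vector is spacelike. -/
theorem lor_self_pos_of_orthogonal_timelike {x t : Mink n} (ht : lor n t t = -1)
    (hxt : lor n t x = 0) (hx : x ≠ 0) : 0 < lor n x x := by
  rw [lor_apply] at *
  have hcs := Finset.sum_mul_sq_le_sq_mul_sq Finset.univ (fun i : Fin n => t i.succ)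
    (fun i : Fin n => x i.succ)
  simp only [← sq] at ht ⊢
  set T := ∑ i : Fin n, t i.succ ^ 2
  set S := ∑ i : Fin n, x i.succ ^ 2 with hS
  have hS0 : 0 ≤ S := Finset.sum_nonneg fun i _ => sq_nonneg _
  have hT0 : 0 ≤ T := Finset.sum_nonneg fun i _ => sq_nonneg _
  have h1 : ∑ i : Fin n, t i.succ * x i.succ = t 0 * x 0 := by linarith
  rw [h1] at hcs
  have hSpos : 0 < S := by
    refine hS0.lt_of_ne fun h => hx ?_
    have hall : ∀ i : Fin n, x i.succ = 0 := fun i =>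
      pow_eq_zero_iff two_ne_zero |>.1
        ((Finset.sum_eq_zero_iff_of_nonneg fun i _ => sq_nonneg _).1 h.symm i (Finset.mem_univ i))
    rw [← h, mul_zero] at hcs
    have h2 : t 0 * x 0 = 0 := pow_eq_zero_iff two_ne_zero |>.1 (le_antisymm hcs (sq_nonneg _))
    have h3 : t 0 ≠ 0 := fun h0 => by rw [h0] at ht; linarith
    have h4 : x 0 = 0 := (mul_eq_zero.1 h2).resolve_left h3
    ext i
    exact Fin.cases h4 hall i
  have h5 : t 0 ^ 2 = 1 + T := by linarith
  -- Cauchy–Schwarz for the space parts, with `t 0 ^ 2 = 1 + T`; since `S > 0`, the factor `T` on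
  -- the right falls short of `1 + T`, which makes the inequality strict.
  have h6 : (1 + T) * x 0 ^ 2 ≤ T * S := by rw [← h5, ← mul_pow]; exact hcs
  have h7 : 0 < (1 + T) * (S - x 0 ^ 2) := by nlinarith
  have := pos_of_mul_pos_right h7 (by linarith)
  linarith

/-- The pseudo scalar product is positive definite on the vectors with vanishing time component. -/
theorem lor_self_pos_of_time_eq_zero {x : Mink n} (h0 : x 0 = 0) (hx : x ≠ 0) :
    0 < lor n x x := by
  refine lor_self_pos_of_orthogonal_timelike (t := Pi.single 0 1) ?_ ?_ hx <;>
    simp [lor_apply, h0, Fin.succ_ne_zero]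

theorem hasStrictFDerivAt_lor {E : Type*} [NormedAddCommGroup E] [NormedSpace ℝ E]
    {f g : E → Mink n} {f' g' : E →L[ℝ] Mink n} {x : E} (hf : HasStrictFDerivAt f f' x)
    (hg : HasStrictFDerivAt g g' x) :
    HasStrictFDerivAt (fun y => lor n (f y) (g y))
      ((lor n (f x)).toContinuousLinearMap.comp g' +
        (lor n (g x)).toContinuousLinearMap.comp f') x := by
  rw [hasStrictFDerivAt_pi'] at hf hg
  have h := ((hf 0).mul (hg 0)).neg.add
    (HasStrictFDerivAt.fun_sum (u := Finset.univ)
      fun i _ => (hf (Fin.succ i)).mul (hg (Fin.succ i)))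
  refine h.congr_fderiv ?_
  ext v
  simp [lor_apply, Finset.sum_add_distrib]
  ring

theorem tanSpace_lightSphere {v : Mink n} (hv : v ∈ lightSphere n) :
    (∀ x, x ∈ tanSpace (lightSphere n) v ↔ lor n v x = 0 ∧ x 0 = 0) ∧
      Module.finrank ℝ (tanSpace (lightSphere n) v) = n - 1 := by
  have hf := (hasStrictFDerivAt_lor (hasStrictFDerivAt_id v) (hasStrictFDerivAt_id v)).prodMk
    ((ContinuousLinearMap.proj (R := ℝ) (φ := fun _ : Fin (n + 1) => ℝ) 0).hasStrictFDerivAt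
      (x := v))
  obtain ⟨f', hf, hf'x⟩ : ∃ f' : Mink n →L[ℝ] ℝ × ℝ,
      HasStrictFDerivAt (fun x : Mink n => (lor n x x, x 0)) f' v ∧
        ∀ x, f' x = (2 * lor n v x, x 0) :=
    ⟨_, hf, fun x => by ext <;> simp [two_mul]⟩
  have hv1 : ∑ i : Fin n, v i.succ * v i.succ = 1 := by
    have := hv.1
    rw [lor_apply, hv.2] at this
    linarith
  have hsurj : f'.range = ⊤ := by
    refine LinearMap.range_eq_top.2 fun ⟨a, b⟩ => ?_
    -- The space part of `v` is a unit vector, so a multiple `c` of it with time component `b` has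
    -- 2⟨v, x⟩ = 2(c - b); solving for `a` gives `c = a / 2 + b`.
    refine ⟨Fin.cons b fun i => (a / 2 + b) * v i.succ, ?_⟩
    change f' _ = _
    rw [hf'x, lor_apply, hv.2]
    simp only [Fin.cons_zero, Fin.cons_succ, mul_left_comm _ (a / 2 + b), ← Finset.mul_sum, hv1]
    ext
    · simp
      ring
    · simp
  have hS : ∀ᶠ x in nhds v, x ∈ lightSphere n ↔
      (lor n x x, x 0) = (lor n v v, v 0) :=
    .of_forall fun x => by simp only [hv.1, hv.2, Prod.mk.injEq]; rfl
  constructor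
  · intro x
    rw [tanSpace_eq_ker hf hsurj hS]
    change f' x = 0 ↔ _
    rw [hf'x]
    simp
  · have := finrank_tanSpace hf hsurj hS
    simp at this
    omega

end Lorentz

/-! ### The unit normal bundle as a level set. -/

section Bundle

variable {s n : ℕ} {U : Set (Fin s → ℝ)} {X nT : (Fin s → ℝ) → Mink n}

theorem fderiv_eq_sum_coordVec (X : (Fin s → ℝ) → Mink n) (u a : Fin s → ℝ) :
    fderiv ℝ X u a = ∑ i, a i • coordVec X u i := by
  conv_lhs => rw [pi_eq_sum_univ' a]
  simp only [map_sum, map_smul, coordVec]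

theorem mem_normalSpace_iff {u : Fin s → ℝ} {w : Mink n} :
    w ∈ normalSpace X u ↔ ∀ i, lor n w (coordVec X u i) = 0 := by
  refine ⟨fun h i => h _, fun h a => ?_⟩
  rw [fderiv_eq_sum_coordVec]
  simp [h]

theorem firstForm_mulVec (X : (Fin s → ℝ) → Mink n) (u a : Fin s → ℝ) (i : Fin s) :
    (firstForm X u).mulVec a i = lor n (coordVec X u i) (fderiv ℝ X u a) := by
  simp [fderiv_eq_sum_coordVec, Matrix.mulVec, dotProduct, firstForm, mul_comm]

/-- A kernel vector of the Gram matrix would give a tangent vector orthogonal to all tangent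
vectors, hence to itself. -/
theorem isUnit_firstForm (hX : IsSpacelikeEmbedding U X) {u : Fin s → ℝ} (hu : u ∈ U) :
    IsUnit (firstForm X u) := by
  rw [← Matrix.mulVec_injective_iff_isUnit, ← Matrix.coe_mulVecLin, injective_iff_map_eq_zero]
  intro c hc
  by_contra h
  refine (hX.spacelike u hu c h).ne' (mem_normalSpace_iff.2 (fun i => ?_) c)
  rw [lor_comm, ← firstForm_mulVec]
  exact congrFun hc i

theorem projTan_apply (X : (Fin s → ℝ) → Mink n) (u : Fin s → ℝ) (w : Mink n) :
    projTan X u w = fderiv ℝ X u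
      (Matrix.vecMul (fun i => lor n (coordVec X u i) w) (firstForm X u)⁻¹) := by
  rw [fderiv_eq_sum_coordVec]
  simp only [projTan, LinearMap.sum_apply, LinearMap.smul_apply, LinearMap.smulRight_apply,
    Matrix.vecMul, dotProduct, Finset.sum_smul, smul_smul]
  rw [Finset.sum_comm]
  simp only [mul_comm]

theorem firstForm_transpose (X : (Fin s → ℝ) → Mink n) (u : Fin s → ℝ) :
    (firstForm X u).transpose = firstForm X u := by
  ext i j
  exact lor_comm _ _

theorem lor_coordVec_projTan (hX : IsSpacelikeEmbedding U X) {u : Fin s → ℝ} (hu : u ∈ U)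
    (w : Mink n) (i : Fin s) :
    lor n (coordVec X u i) (projTan X u w) = lor n (coordVec X u i) w := by
  rw [projTan_apply, ← firstForm_mulVec, ← Matrix.vecMul_transpose, firstForm_transpose,
    Matrix.vecMul_vecMul, Matrix.nonsing_inv_mul _ ((Matrix.isUnit_iff_isUnit_det _).1
      (isUnit_firstForm hX hu)), Matrix.vecMul_one]

/-- The defining equations of `N₁(M)[nT]`. -/
noncomputable def bundleEqs (X nT : (Fin s → ℝ) → Mink n) (q : (Fin s → ℝ) × Mink n) :
    (Fin s → ℝ) × ℝ × ℝ :=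
  (fun i => lor n q.2 (coordVec X q.1 i), lor n q.2 q.2, lor n q.2 (nT q.1))

theorem mem_unitBundle_iff {q : (Fin s → ℝ) × Mink n} (hq : q.1 ∈ U) :
    q ∈ unitBundle U X nT ↔ bundleEqs X nT q = (0, 1, 0) := by
  simp only [unitBundle, bundleEqs, Set.mem_ofPred_eq, hq, true_and, mem_normalSpace_iff,
    Prod.mk.injEq, funext_iff, Pi.zero_apply]

/-- Only vertical directions are computed: they already suffice for surjectivity, and they avoid the
second derivatives of `X`. -/
theorem exists_hasStrictFDerivAt_bundleEqs (hX : IsSpacelikeEmbedding U X)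
    (hn : IsFutureUnitNormal U X nT) {q : (Fin s → ℝ) × Mink n} (hq : q.1 ∈ U) :
    ∃ f' : (Fin s → ℝ) × Mink n →L[ℝ] (Fin s → ℝ) × ℝ × ℝ,
      HasStrictFDerivAt (bundleEqs X nT) f' q ∧ ∀ η, f' (0, η) =
        (fun i => lor n (coordVec X q.1 i) η, 2 * lor n q.2 η, lor n (nT q.1) η) := by
  have hU := hX.isOpen.mem_nhds hq
  have hXd : ContDiffAt ℝ 1 (fderiv ℝ X) q.1 :=
    (hX.contDiffOn.contDiffAt hU).fderiv_right (by norm_cast)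
  have hc i : HasStrictFDerivAt (fun u => coordVec X u i)
      (fderiv ℝ (fun u => coordVec X u i) q.1) q.1 :=
    (hXd.clm_apply contDiffAt_const).hasStrictFDerivAt one_ne_zero
  have hnd := (hn.contDiffOn.contDiffAt hU).hasStrictFDerivAt (by simp)
  have h1 := hasStrictFDerivAt_fst (𝕜 := ℝ) (p := q)
  have h2 := hasStrictFDerivAt_snd (𝕜 := ℝ) (p := q)
  refine ⟨_, (hasStrictFDerivAt_pi.2 fun i =>
    hasStrictFDerivAt_lor h2 ((hc i).comp q h1)).prodMk
      ((hasStrictFDerivAt_lor h2 h2).prodMk (hasStrictFDerivAt_lor h2 (hnd.comp q h1))), ?_⟩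
  intro η
  ext <;> simp [two_mul]

theorem tanSpace_unitBundle (hX : IsSpacelikeEmbedding U X)
    (hn : IsFutureUnitNormal U X nT) {q : (Fin s → ℝ) × Mink n} (hq : q ∈ unitBundle U X nT) :
    (∀ η, (0, η) ∈ tanSpace (unitBundle U X nT) q → lor n q.2 η = 0 ∧ lor n (nT q.1) η = 0 ∧
      ∀ i, lor n (coordVec X q.1 i) η = 0) ∧
    Module.finrank ℝ (tanSpace (unitBundle U X nT) q) = n - 1 := by
  obtain ⟨f', hf, hf'⟩ := exists_hasStrictFDerivAt_bundleEqs hX hn hq.1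
  -- As `U` is open, the condition `p.1 ∈ U` is automatic near `q`.
  have hS : ∀ᶠ p in nhds q, p ∈ unitBundle U X nT ↔ bundleEqs X nT p = bundleEqs X nT q := by
    filter_upwards [continuous_fst.continuousAt.preimage_mem_nhds (hX.isOpen.mem_nhds hq.1)]
      with p hp
    have hp : p.1 ∈ U := hp
    rw [mem_unitBundle_iff hp, (mem_unitBundle_iff hq.1).1 hq]
  have hsurj : f'.range = ⊤ := by
    -- Vertical vectors in the span of T_pM, ξ and `nT` are enough: there the derivative is block
    -- diagonal with blocks the first form, 2 and -1, hence an injective endomorphism `K`.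
    let G : (Fin s → ℝ) × ℝ × ℝ →ₗ[ℝ] Mink n :=
      (fderiv ℝ X q.1 : (Fin s → ℝ) →ₗ[ℝ] Mink n).coprod
        ((LinearMap.toSpanSingleton ℝ _ q.2).coprod (LinearMap.toSpanSingleton ℝ _ (nT q.1)))
    have hG c a b : G (c, a, b) = fderiv ℝ X q.1 c + (a • q.2 + b • nT q.1) := by
      simp [G]
    let K : (Fin s → ℝ) × ℝ × ℝ →ₗ[ℝ] (Fin s → ℝ) × ℝ × ℝ :=
      (f' : (Fin s → ℝ) × Mink n →ₗ[ℝ] (Fin s → ℝ) × ℝ × ℝ) ∘ₗ LinearMap.inr ℝ _ _ ∘ₗ G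
    have hK z : K z = f' (0, G z) := rfl
    have hinj : Function.Injective K := by
      rw [injective_iff_map_eq_zero]
      rintro ⟨c, a, b⟩ hz
      rw [hK, hf', hG] at hz
      simp only [Prod.mk_eq_zero, funext_iff, Pi.zero_apply, map_add, map_smul, smul_eq_mul,
        hq.2.2.1, hn.unit _ hq.1, lor_comm (coordVec _ _ _) q.2,
        lor_comm (coordVec _ _ _) (nT q.1), mem_normalSpace_iff.1 hq.2.1 _,
        mem_normalSpace_iff.1 (hn.normal _ hq.1) _, hq.2.1 _, hn.normal _ hq.1 _, hq.2.2.2,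
        lor_comm (nT q.1) q.2] at hz
      obtain ⟨h1, h2, h3⟩ := hz
      have ha : a = 0 := by linarith
      have hb : b = 0 := by linarith
      subst ha hb
      suffices c = 0 by rw [this]; rfl
      by_contra h
      refine (hX.spacelike _ hq.1 c h).ne' (mem_normalSpace_iff.2 (fun i => ?_) c)
      rw [lor_comm]
      simpa using h1 i
    refine LinearMap.range_eq_top.2 fun y => ?_
    obtain ⟨z, hz⟩ := LinearMap.injective_iff_surjective.1 hinj y
    exact ⟨_, hz⟩
  constructor
  · intro η hη
    rw [tanSpace_eq_ker hf hsurj hS] at hη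
    have hη' : f' (0, η) = 0 := hη
    rw [hf'] at hη'
    simpa [funext_iff, and_comm, and_assoc, and_left_comm] using hη'
  · have := finrank_tanSpace hf hsurj hS
    simp at this
    omega

end Bundle

/-! ### The identification `tanIdent` and the projection Π^τ. -/

section BundleProjection

variable {s n : ℕ} {U : Set (Fin s → ℝ)} {X nT : (Fin s → ℝ) → Mink n}

theorem lor_projTan_eq_zero {u : Fin s → ℝ} {t : Mink n} (ht : t ∈ normalSpace X u) (w : Mink n) :
    lor n t (projTan X u w) = 0 := by
  rw [projTan_apply]
  exact ht _

theorem projVert_apply (q : (Fin s → ℝ) × Mink n) (w : Mink n) :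
    projVert X nT q w =
      w - projTan X q.1 w + lor n (nT q.1) w • nT q.1 - lor n q.2 w • q.2 := rfl

/-- The orthogonal complement of `nT(u)` and `ξ`, that is, `T_p M ⊕ T_ξ N₁(M)_p[nT]`. -/
noncomputable def bundleSpace (nT : (Fin s → ℝ) → Mink n) (q : (Fin s → ℝ) × Mink n) :
    Submodule ℝ (Mink n) :=
  LinearMap.ker ((lor n (nT q.1)).prod (lor n q.2))

theorem mem_bundleSpace {q : (Fin s → ℝ) × Mink n} {x : Mink n} :
    x ∈ bundleSpace nT q ↔ lor n (nT q.1) x = 0 ∧ lor n q.2 x = 0 := by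
  simp [bundleSpace]

theorem finrank_bundleSpace (hn : IsFutureUnitNormal U X nT) {q : (Fin s → ℝ) × Mink n}
    (hq : q ∈ unitBundle U X nT) : Module.finrank ℝ (bundleSpace nT q) = n - 1 := by
  have hs : LinearMap.range ((lor n (nT q.1)).prod (lor n q.2)) = ⊤ := by
    refine LinearMap.range_eq_top.2 fun ⟨a, b⟩ => ⟨-a • nT q.1 + b • q.2, ?_⟩
    simp [hn.unit _ hq.1, hq.2.2.1, hq.2.2.2, lor_comm (nT q.1) q.2]
  have := LinearMap.finrank_range_add_finrank_ker ((lor n (nT q.1)).prod (lor n q.2))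
  rw [hs, finrank_top] at this
  simp at this
  change _ + Module.finrank ℝ (bundleSpace nT q) = _ at this
  omega

theorem tanIdent_apply {q : (Fin s → ℝ) × Mink n} (v : tanSpace (unitBundle U X nT) q) :
    tanIdent U X nT q v = fderiv ℝ X q.1 v.1.1 + projVert X nT q v.1.2 := rfl

theorem tanIdent_mem_bundleSpace (hn : IsFutureUnitNormal U X nT) {q : (Fin s → ℝ) × Mink n}
    (hq : q ∈ unitBundle U X nT) (v : tanSpace (unitBundle U X nT) q) :
    tanIdent U X nT q v ∈ bundleSpace nT q := by
  have h1 := hn.normal _ hq.1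
  have h2 := hq.2.1
  rw [mem_bundleSpace, tanIdent_apply, projVert_apply]
  simp [h1 _, h2 _, lor_projTan_eq_zero h1, lor_projTan_eq_zero h2, hn.unit _ hq.1, hq.2.2.1,
    hq.2.2.2, lor_comm (nT q.1) q.2]

/-- The two summands are orthogonal, so a vanishing sum forces dX(a) to be orthogonal to itself, and
a = 0. The vector is then vertical, and `projVert` fixes vectors already tangent to the fibre. -/
theorem ker_tanIdent (hX : IsSpacelikeEmbedding U X) (hn : IsFutureUnitNormal U X nT)
    {q : (Fin s → ℝ) × Mink n} (hq : q ∈ unitBundle U X nT) :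
    LinearMap.ker (tanIdent U X nT q) = ⊥ := by
  rw [LinearMap.ker_eq_bot']
  rintro ⟨⟨a, η⟩, hv⟩ h
  rw [tanIdent_apply] at h
  simp only at h
  have hvert i : lor n (coordVec X q.1 i) (projVert X nT q η) = 0 := by
    have h1 := mem_normalSpace_iff.1 (hn.normal _ hq.1) i
    have h2 := mem_normalSpace_iff.1 hq.2.1 i
    rw [lor_comm] at h1 h2
    rw [projVert_apply]
    simp [lor_coordVec_projTan hX hq.1, h1, h2]
  have ha : a = 0 := by
    by_contra ha
    refine (hX.spacelike _ hq.1 a ha).ne' (mem_normalSpace_iff.2 (fun i => ?_) a)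
    rw [eq_neg_of_add_eq_zero_left h, map_neg, LinearMap.neg_apply, lor_comm, hvert, neg_zero]
  subst ha
  obtain ⟨h1, h2, h3⟩ := (tanSpace_unitBundle hX hn hq).1 η hv
  have hη : η = 0 := by
    have ht : projTan X q.1 η = 0 := by
      rw [projTan_apply]
      simp [h3, ← Pi.zero_def]
    simpa [projVert_apply, h1, h2, ht] using h
  subst hη
  rfl

/-- Inclusion plus equality of dimensions. It places the values of the orthogonal projection in the
range of `tanIdent`, where the left inverse in `projBundle` is a true inverse. -/
theorem range_tanIdent (hX : IsSpacelikeEmbedding U X) (hn : IsFutureUnitNormal U X nT)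
    {q : (Fin s → ℝ) × Mink n} (hq : q ∈ unitBundle U X nT) :
    LinearMap.range (tanIdent U X nT q) = bundleSpace nT q := by
  refine Submodule.eq_of_le_of_finrank_eq ?_ ?_
  · rintro _ ⟨v, rfl⟩
    exact tanIdent_mem_bundleSpace hn hq v
  · rw [LinearMap.finrank_range_of_inj (LinearMap.ker_eq_bot.1 (ker_tanIdent hX hn hq)),
      (tanSpace_unitBundle hX hn hq).2, finrank_bundleSpace hn hq]

theorem unitBundleMetric_pos (hX : IsSpacelikeEmbedding U X) (hn : IsFutureUnitNormal U X nT)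
    {q : (Fin s → ℝ) × Mink n} (hq : q ∈ unitBundle U X nT)
    {v : tanSpace (unitBundle U X nT) q} (hv : v ≠ 0) : 0 < unitBundleMetric U X nT q v v :=
  lor_self_pos_of_orthogonal_timelike (hn.unit _ hq.1)
    (mem_bundleSpace.1 (tanIdent_mem_bundleSpace hn hq v)).1
    fun h => hv (LinearMap.ker_eq_bot'.1 (ker_tanIdent hX hn hq) v h)

/-- `tanIdent` after `projBundle` is the orthogonal projection onto the complement of `nT(u)`
and `ξ`. -/
theorem tanIdent_projBundle (hX : IsSpacelikeEmbedding U X) (hn : IsFutureUnitNormal U X nT)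
    {q : (Fin s → ℝ) × Mink n} (hq : q ∈ unitBundle U X nT) (w : Mink n) :
    tanIdent U X nT q (projBundle U X nT q w) =
      w + lor n (nT q.1) w • nT q.1 - lor n q.2 w • q.2 := by
  have hw : w + lor n (nT q.1) w • nT q.1 - lor n q.2 w • q.2 ∈ bundleSpace nT q := by
    rw [mem_bundleSpace]
    simp [hn.unit _ hq.1, hq.2.2.1, hq.2.2.2, lor_comm (nT q.1) q.2]
  rw [← range_tanIdent hX hn hq] at hw
  obtain ⟨v, hv⟩ := hw
  have hP : (projTan X q.1 + projVert X nT q) w = tanIdent U X nT q v := by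
    rw [hv, LinearMap.add_apply, projVert_apply]
    abel
  have hinv := LinearMap.leftInverse_apply_of_inj (ker_tanIdent hX hn hq) v
  rw [projBundle, LinearMap.comp_apply, hP, hinv, hv]

/-- The projection `Π^τ` restricts to an isometry on the tangent spaces of the lightcone unit
sphere at the values of the Gauss map, since these are orthogonal to the lightlike `nT(u) + ξ`. -/
theorem projBundle_isometry (hX : IsSpacelikeEmbedding U X) (hn : IsFutureUnitNormal U X nT)
    {q : (Fin s → ℝ) × Mink n} (hq : q ∈ unitBundle U X nT)
    (x y : tanSpace (lightSphere n) (gaussMap nT q)) :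
    unitBundleMetric U X nT q (projBundle U X nT q x) (projBundle U X nT q y) =
      lightSphereMetric n (gaussMap nT q) x y := by
  have horth {z : Mink n} (hz : z ∈ tanSpace (lightSphere n) (gaussMap nT q)) :
      lor n q.2 z = -lor n (nT q.1) z := by
    have h1 := (((tanSpace_lightSphere (gaussMap_mapsTo hn hq)).1 _).1 hz).1
    have h0 := (gaussImage_mapsTo hn hq).1
    simp only [gaussMap, lightNormalize, map_smul, LinearMap.smul_apply, smul_eq_mul] at h1
    have h2 := (mul_eq_zero.1 h1).resolve_left (inv_ne_zero h0)
    rw [show gaussImage nT q = nT q.1 + q.2 from rfl, map_add, LinearMap.add_apply] at h2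
    linarith
  change lor n (tanIdent U X nT q _) (tanIdent U X nT q _) = lor n (x : Mink n) y
  rw [tanIdent_projBundle hX hn hq, tanIdent_projBundle hX hn hq]
  -- By `horth` the projected vectors are x + ⟨`nT`, x⟩ ℓ and y + ⟨`nT`, y⟩ ℓ with ℓ = `nT` + ξ null
  -- and orthogonal to x and y, so all cross terms cancel.
  simp only [map_add, map_sub, map_smul, LinearMap.add_apply, LinearMap.sub_apply,
    LinearMap.smul_apply, smul_eq_mul, hn.unit _ hq.1, hq.2.2.1, hq.2.2.2,
    lor_comm (nT q.1) q.2, lor_comm (x : Mink n) q.2, lor_comm (x : Mink n) (nT q.1), horth x.2, horth y.2]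
  ring

end BundleProjection

/-! ### The comparison of volume elements. -/

theorem theorem6p1 {n s k : ℕ} (hsk : s + k = n + 1) {U : Set (Fin s → ℝ)}
    {X nT : (Fin s → ℝ) → Mink n} (hX : IsSpacelikeEmbedding U X)
    (hn : IsFutureUnitNormal U X nT) (q : (Fin s → ℝ) × Mink n) (hq : q ∈ unitBundle U X nT) :
    (∃ ωS : tanSpace (lightSphere n) (gaussMap nT q) [⋀^Fin (n - 1)]→ₗ[ℝ] ℝ,
      IsVolumeForm (lightSphereMetric n (gaussMap nT q)) ωS) ∧
    (∃ ωN : tanSpace (unitBundle U X nT) q [⋀^Fin (n - 1)]→ₗ[ℝ] ℝ,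
      IsVolumeForm (unitBundleMetric U X nT q) ωN) ∧
    ∀ (ωS : tanSpace (lightSphere n) (gaussMap nT q) [⋀^Fin (n - 1)]→ₗ[ℝ] ℝ)
      (ωN : tanSpace (unitBundle U X nT) q [⋀^Fin (n - 1)]→ₗ[ℝ] ℝ),
      IsVolumeForm (lightSphereMetric n (gaussMap nT q)) ωS →
      IsVolumeForm (unitBundleMetric U X nT q) ωN →
      ωS.compLinearMap (tanMap (gaussMap nT) (gaussMap_mapsTo hn) q) =
          |lipschitzKilling hn q| • ωN ∨
        ωS.compLinearMap (tanMap (gaussMap nT) (gaussMap_mapsTo hn) q) =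
          -(|lipschitzKilling hn q| • ωN) := by
  obtain ⟨hS, hSdim⟩ := tanSpace_lightSphere (gaussMap_mapsTo hn hq)
  refine ⟨?_, ?_, fun _ _ hωS hωN => ?_⟩
  · refine exists_isVolumeForm (g := lightSphereMetric n (gaussMap nT q)) (fun _ _ => lor_comm _ _)
      (fun x hx => ?_) hSdim
    exact lor_self_pos_of_time_eq_zero ((hS x).1 x.2).2 (by simpa using hx)
  · exact exists_isVolumeForm (g := unitBundleMetric U X nT q) (fun _ _ => lor_comm _ _)
      (fun _ hx => unitBundleMetric_pos hX hn hq hx) (tanSpace_unitBundle hX hn hq).2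
  -- With `A` the restriction of Π^τ, `lipschitzKilling` is det(-A ∘ D) up to reassociating the
  -- composition, which is definitional.
  · exact hωS.compLinearMap_eq
      (A := (projBundle U X nT q).comp (tanSpace (lightSphere n) (gaussMap nT q)).subtype)
      (projBundle_isometry hX hn hq) _ hωN
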